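/- Theorem 1. Words are over the alphabet $A=\{0,\dots,b-1\}$, where $b\ge 2$ is an integer. For positive integers $k,m$, a circular word (a word up to rotation) is $(k,m)$-perfect if each word of length $k$ over $A$ occurs in it exactly $m$ times, at positions that are pairwise different modulo $m$ (for any choice of the starting point); its length is then $m b^k$. A word $w$ of length $m b^k$ is a $(k,m)$-nested perfect necklace if for each $\ell=1,\dots,k$ each block of $w$ of length $m b^\ell$ that starts at a position congruent to $1$ modulo $m b^\ell$ (positions numbered from $1$) is, viewed as a circular word, $(\ell,m)$-perfect. For $m=2^d$ let $P_m$ be the $m\times m$ Pascal triangle matrix modulo $2$, with entries $p_{i,j}\in\{0,1\}$, $p_{i,j}\equiv\binom{i+j}{i} \pmod 2$, $0\le i,j<m$. For $0\le n<b^m$ write $n=\sum_{j<m}e_j(n)\,b^j$ with $e_j(n)\in A$, and let $W_m(n)$ be the word of length $m$ whose $i$-th symbol ($0\le i<m$) is the element of $A$ congruent to $\sum_{j<m}p_{i,j}\,e_j(n)$ modulo $b$. Levin's number $x_b$ is the real number in $[0,1)$ whose base-$b$ digits after the point are obtained by concatenating, for $m=2^d$ with $d=0,1,2,\dots$, the blocks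 $W_m(0)W_m(1)\cdots W_m(b^m-1)$; that is, $$x_b=\sum_{d\ge0}\ \sum_{n=0}^{b^{2^d}-1}\ \sum_{i=0}^{2^d-1}\frac{W_{2^d}(n)_i}{b^{\,s_d+n2^d+i+1}},\qquad s_d=\sum_{r<d}2^r b^{2^r}.$$ For every integer $b\ge2$ the following holds. (1) The base-$b$ expansion of Levin's number $x_b$ (after the radix point) is a concatenation $V_0V_1V_2\cdots$ where, for each $d\ge 0$, $V_d$ is an $(m,m)$-nested perfect necklace with $m=2^d$. (2) Conversely, let $x$ be any real number whose base-$b$ expansion (after the radix point) is a concatenation $V_0V_1V_2\cdots$ where, for each $d\ge 0$, $V_d$ is an $(m,m)$-nested perfect necklace with $m=2^d$. Then the discrepancy of the first $N$ terms of $(\{b^nx\})_{n\ge1}$, $$D_N=\sup_{0\le\alpha<\beta\le1}\left|\frac1N\,\#\{1\le n\le N:\ \alpha\le\{b^nx\}<\beta\}-(\beta-\alpha)\right|,$$ satisfies $D_N=O\big((\log N)^2/N\big)$ as $N\to\infty$. -/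

import Mathlib

/-- The positions `p < |w|` at which the word `u` occurs in the circular word `w`, that is, such
that reading `w` cyclically from position `p` on gives the symbols of `u`. -/
def circularOccurrences {A : Type*} [DecidableEq A] (w u : List A) : Finset ℕ :=
  (Finset.range w.length).filter fun p =>
    ∀ j ∈ Finset.range u.length, w[(p + j) % w.length]? = u[j]?

/-- The circular word with representative `w` is `(k, m)`-perfect: each word of length `k` occurs
in it exactly `m` times, at positions which are pairwise different modulo `m`. For every such `w`
one has `|w| = m |A| ^ k`, a multiple of `m`, so this does not depend on the starting point. -/
def IsPerfectNecklace {A : Type*} [DecidableEq A] (k m : ℕ) (w : List A) : Prop :=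
  ∀ u : List A, u.length = k →
    (circularOccurrences w u).card = m ∧
    ∀ p ∈ circularOccurrences w u, ∀ q ∈ circularOccurrences w u, p ≡ q [MOD m] → p = q

/-- `w` is a `(k, m)`-nested perfect necklace: a word of length `m |A| ^ k` such that, for each
`ℓ = 1, …, k`, each block of `w` of length `m |A| ^ ℓ` starting at a position (numbered from `0`)
divisible by `m |A| ^ ℓ` is an `(ℓ, m)`-perfect necklace. -/
structure IsNestedPerfectNecklace {A : Type*} [Fintype A] [DecidableEq A] (k m : ℕ)
    (w : List A) : Prop where
  length_eq : w.length = m * Fintype.card A ^ k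
  perfect : ∀ ℓ, 1 ≤ ℓ → ℓ ≤ k → ∀ j < Fintype.card A ^ (k - ℓ),
    IsPerfectNecklace ℓ m
      ((w.drop (j * (m * Fintype.card A ^ ℓ))).take (m * Fintype.card A ^ ℓ))

/-- The position (numbered from `0`) at which the `d`-th block starts, when for
`r = 0, 1, 2, …` the `r`-th block has length `2 ^ r * b ^ (2 ^ r)`. -/
def blockStart (b d : ℕ) : ℕ :=
  ∑ r ∈ Finset.range d, 2 ^ r * b ^ 2 ^ r

/-- The infinite word `a` over `{0, …, b - 1}` is a concatenation `W₀ W₁ W₂ …` where, for each `d`,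
`W_d` is an `(m, m)`-nested perfect necklace with `m = 2 ^ d`. -/
def IsNestedPerfectConcatenation {b : ℕ} (a : ℕ → Fin b) : Prop :=
  ∀ d : ℕ, IsNestedPerfectNecklace (2 ^ d) (2 ^ d)
    (List.ofFn fun i : Fin (2 ^ d * b ^ 2 ^ d) => a (blockStart b d + i))

/-- The Pascal triangle matrix modulo `2`, with rows and columns numbered from `0`. -/
def pascalMod2 (i j : ℕ) : ℕ := (i + j).choose i % 2

/-- The `i`-th digit of the `n`-th word in the block of order `m` of Levin's construction: the
`i`-th coordinate, modulo `b`, of the product of the `m × m` Pascal matrix mod `2` with the vector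
of the `m` base-`b` digits of `n`, least significant digit first. -/
def levinDigit (b m n i : ℕ) : ℕ :=
  (∑ j ∈ Finset.range m, pascalMod2 i j * (n / b ^ j % b)) % b

/-- Levin's number in base `b`. Its `d`-th block, `m = 2 ^ d`, lists the words
`levinDigit b m n 0 … levinDigit b m n (m - 1)` for `n = 0, …, b ^ m - 1`. -/
noncomputable def levinNumber (b : ℕ) : ℝ :=
  ∑' d : ℕ, ∑ n ∈ Finset.range (b ^ 2 ^ d), ∑ i ∈ Finset.range (2 ^ d),
    (levinDigit b (2 ^ d) n i : ℝ) / (b : ℝ) ^ (blockStart b d + n * 2 ^ d + i + 1)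

open Classical in
/-- The discrepancy of the first `N` terms `y 0, …, y (N - 1)` of a sequence in `[0, 1)`. -/
noncomputable def discrepancy (y : ℕ → ℝ) (N : ℕ) : ℝ :=
  sSup {r : ℝ | ∃ α β : ℝ, 0 ≤ α ∧ α < β ∧ β ≤ 1 ∧
    r = |1 / (N : ℝ) * (((Finset.range N).filter fun n => α ≤ y n ∧ y n < β).card : ℝ)
      - (β - α)|}

/-!
Levin's number and the discrepancy of concatenations of nested perfect necklaces.

**Levin's blocks are nested perfect necklaces.** Let `m = 2 ^ d`. The factor of length `ℓ` at a
position congruent to `i` modulo `m`, in an aligned block of `b ^ ℓ` words, is given by Pascal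
matrices over `ZMod b` applied to the digits of the index `t` of the word where it starts and of
`t + 1` (modulo `b ^ ℓ`), and it suffices that `t` can be recovered from it
(`isPerfectNecklace_of_injective`): then each word of length `ℓ` occurs once for each `i`.
If the factor lies inside one word, this says that `ℓ` consecutive rows of the first `ℓ` columns
of the Pascal triangle modulo 2 form an injective matrix. That holds over every abelian group, so
for composite `b` too (`eq_zero_of_pascalMod2_rows`): modulo 2 the triangle is a Kronecker power of
`!![1, 1; 1, 0]`, and sorting rows and columns by parity reduces the size by half. If the factor
runs over the end of a word, its first part determines the low digits of `t`, because the
triangle vanishes where `i + j ≥ m`; these determine the low digits of `t + 1`, and the second part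
determines the others by the transposed statement (`eq_zero_of_pascalMod2_columns`).
Levin's blocks start with a word of zeros, so the constructed sequence does not end in digits
`b - 1` only, and it is the digit sequence of its value (`digits_ofDigits`).

**Discrepancy.** In an `(ℓ, m)`-perfect necklace with `ℓ ≤ m`, the number of positions with
`{b ^ n x} < γ` differs from its expected value by at most `2 m`
(`abs_countError_necklace_le`). A prefix of the `d`-th block is cut into fewer than `b` aligned
blocks of each order `ℓ < m` and a rest shorter than `m`, so that its error is `O(m ^ 2)`
(`abs_countError_prefix_le`). The earlier blocks add `O(m)` altogether, and `m = O(log N)` since the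
`(d - 1)`-th block alone has length at least `b ^ (m / 2)`.
-/

/-! ### The Pascal triangle modulo 2 -/

theorem pascalMod2_comm (i j : ℕ) : pascalMod2 i j = pascalMod2 j i := by
  unfold pascalMod2
  rw [Nat.choose_symm_add, add_comm]

theorem pascalMod2_zero_right (i : ℕ) : pascalMod2 i 0 = 1 := by
  simp [pascalMod2]

theorem pascalMod2_even_even (i j : ℕ) : pascalMod2 (2 * i) (2 * j) = pascalMod2 i j := by
  have h := Choose.choose_modEq_choose_mod_mul_choose_div_nat (p := 2)
    (n := 2 * i + 2 * j) (k := 2 * i)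
  rw [show (2 * i + 2 * j) % 2 = 0 by omega, show 2 * i % 2 = 0 by omega,
    show (2 * i + 2 * j) / 2 = i + j by omega, show 2 * i / 2 = i by omega] at h
  simpa [Nat.ModEq, pascalMod2] using h

theorem pascalMod2_even_odd (i j : ℕ) : pascalMod2 (2 * i) (2 * j + 1) = pascalMod2 i j := by
  have h := Choose.choose_modEq_choose_mod_mul_choose_div_nat (p := 2)
    (n := 2 * i + (2 * j + 1)) (k := 2 * i)
  rw [show (2 * i + (2 * j + 1)) % 2 = 1 by omega, show 2 * i % 2 = 0 by omega,
    show (2 * i + (2 * j + 1)) / 2 = i + j by omega, show 2 * i / 2 = i by omega] at h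
  simpa [Nat.ModEq, pascalMod2] using h

theorem pascalMod2_odd_even (i j : ℕ) : pascalMod2 (2 * i + 1) (2 * j) = pascalMod2 i j := by
  rw [pascalMod2_comm, pascalMod2_even_odd, pascalMod2_comm]

theorem pascalMod2_odd_odd (i j : ℕ) : pascalMod2 (2 * i + 1) (2 * j + 1) = 0 := by
  have h := Choose.choose_modEq_choose_mod_mul_choose_div_nat (p := 2)
    (n := 2 * i + 1 + (2 * j + 1)) (k := 2 * i + 1)
  rw [show (2 * i + 1 + (2 * j + 1)) % 2 = 0 by omega, show (2 * i + 1) % 2 = 1 by omega] at h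
  simpa [Nat.ModEq, pascalMod2] using h

/-- If `i, j < 2 ^ d` and `i + j` overflows, then `i` and `j` have a common binary digit `1`. -/
theorem pascalMod2_eq_zero_of_le_add (d : ℕ) {i j : ℕ} (hi : i < 2 ^ d) (hj : j < 2 ^ d)
    (h : 2 ^ d ≤ i + j) : pascalMod2 i j = 0 := by
  induction d generalizing i j with
  | zero => simp at hi hj h; omega
  | succ d ih =>
    rw [pow_succ] at hi hj h
    obtain ⟨k, rfl | rfl⟩ := Nat.even_or_odd' i <;> obtain ⟨l, rfl | rfl⟩ := Nat.even_or_odd' j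
    · rw [pascalMod2_even_even]; exact ih (by omega) (by omega) (by omega)
    · rw [pascalMod2_even_odd]; exact ih (by omega) (by omega) (by omega)
    · rw [pascalMod2_odd_even]; exact ih (by omega) (by omega) (by omega)
    · exact pascalMod2_odd_odd _ _

section Window

variable {G : Type*} [AddCommGroup G]

theorem sum_range_two_mul (f : ℕ → G) (q : ℕ) :
    ∑ j ∈ Finset.range (2 * q), f j = ∑ j ∈ Finset.range q, (f (2 * j) + f (2 * j + 1)) := by
  induction q with
  | zero => simp
  | succ q ih => rw [mul_add, mul_one, Finset.sum_range_succ, Finset.sum_range_succ, ih,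
      Finset.sum_range_succ, add_assoc]

theorem sum_pascalMod2_even_row (v : ℕ → G) (k q : ℕ) :
    ∑ j ∈ Finset.range (2 * q), pascalMod2 (2 * k) j • v j =
      ∑ j ∈ Finset.range q, pascalMod2 k j • (v (2 * j) + v (2 * j + 1)) := by
  rw [sum_range_two_mul]
  simp only [pascalMod2_even_even, pascalMod2_even_odd, smul_add]

theorem sum_pascalMod2_odd_row (v : ℕ → G) (k q : ℕ) :
    ∑ j ∈ Finset.range (2 * q), pascalMod2 (2 * k + 1) j • v j =
      ∑ j ∈ Finset.range q, pascalMod2 k j • v (2 * j) := by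
  rw [sum_range_two_mul]
  simp only [pascalMod2_odd_even, pascalMod2_odd_odd, zero_smul, add_zero]

/-- Any `ℓ` consecutive rows of the first `ℓ` columns of the Pascal triangle modulo 2 form a
matrix which acts injectively on `ℓ`-tuples from any abelian group. Separating even and odd rows
and columns, the matrix splits into two matrices of the same kind of half the size. -/
theorem eq_zero_of_pascalMod2_rows (ℓ : ℕ) : ∀ (i : ℕ) (v : ℕ → G),
    (∀ k, i ≤ k → k < i + ℓ → ∑ j ∈ Finset.range ℓ, pascalMod2 k j • v j = 0) →
    ∀ j < ℓ, v j = 0 := by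
  induction ℓ using Nat.strong_induction_on with
  | _ ℓ ih =>
  intro i v h
  obtain ⟨q, rfl | rfl⟩ := Nat.even_or_odd' ℓ
  · rcases Nat.eq_zero_or_pos q with rfl | hq
    · intro j hj; omega
    have he : ∀ j < q, v (2 * j) = 0 := ih q (by omega) (i / 2) (fun j => v (2 * j))
      fun k h1 h2 => by
        rw [← sum_pascalMod2_odd_row]; exact h _ (by omega) (by omega)
    have ho : ∀ j < q, v (2 * j) + v (2 * j + 1) = 0 := ih q (by omega) ((i + 1) / 2)
      (fun j => v (2 * j) + v (2 * j + 1)) fun k h1 h2 => by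
        rw [← sum_pascalMod2_even_row]; exact h _ (by omega) (by omega)
    intro j hj
    obtain ⟨l, rfl | rfl⟩ := Nat.even_or_odd' j
    · exact he l (by omega)
    · have := ho l (by omega)
      rwa [he l (by omega), zero_add] at this
  rcases Nat.eq_zero_or_pos q with rfl | hq
  · intro j hj
    have := h i le_rfl (by omega)
    obtain rfl : j = 0 := by omega
    simpa [pascalMod2_zero_right] using this
  have hodd : ∀ k, i ≤ 2 * k + 1 → 2 * k + 1 < i + (2 * q + 1) →
      ∑ j ∈ Finset.range (q + 1), pascalMod2 k j • v (2 * j) = 0 := fun k h1 h2 => by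
    have := h _ h1 h2
    rw [Finset.sum_range_succ, sum_pascalMod2_odd_row, pascalMod2_odd_even] at this
    rwa [Finset.sum_range_succ]
  have heven : ∀ k, i ≤ 2 * k → 2 * k < i + (2 * q + 1) →
      ∑ j ∈ Finset.range q, pascalMod2 k j • (v (2 * j) + v (2 * j + 1)) +
        pascalMod2 k q • v (2 * q) = 0 := fun k h1 h2 => by
    have := h _ h1 h2
    rwa [Finset.sum_range_succ, sum_pascalMod2_even_row, pascalMod2_even_even] at this
  -- In both cases the parity class with `q + 1` rows is solved first.
  obtain ⟨he, ho⟩ : (∀ j < q + 1, v (2 * j) = 0) ∧ ∀ j < q, v (2 * j) + v (2 * j + 1) = 0 := by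
    obtain ⟨k, rfl | rfl⟩ := Nat.even_or_odd' i
    · have hu := ih (q + 1) (by omega) k
        (fun j => if j < q then v (2 * j) + v (2 * j + 1) else v (2 * q)) fun l h1 h2 => by
          rw [Finset.sum_range_succ]
          simp only [lt_irrefl, if_false]
          rw [← heven l (by omega) (by omega)]
          congr 1
          exact Finset.sum_congr rfl fun j hj => by rw [if_pos (Finset.mem_range.1 hj)]
      have hq0 : v (2 * q) = 0 := by simpa using hu q (by omega)
      have he := ih q (by omega) k (fun j => v (2 * j)) fun l h1 h2 => by
        have := hodd l (by omega) (by omega)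
        rwa [Finset.sum_range_succ, hq0, smul_zero, add_zero] at this
      refine ⟨fun j hj => ?_, fun j hj => by simpa [hj] using hu j (by omega)⟩
      rcases Nat.lt_succ_iff_lt_or_eq.1 hj with h' | rfl
      · exact he j h'
      · exact hq0
    · have he := ih (q + 1) (by omega) k (fun j => v (2 * j)) fun l h1 h2 =>
        hodd l (by omega) (by omega)
      have hq0 : v (2 * q) = 0 := he q (by omega)
      refine ⟨he, ih q (by omega) (k + 1) (fun j => v (2 * j) + v (2 * j + 1)) fun l h1 h2 => ?_⟩
      have := heven l (by omega) (by omega)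
      rwa [hq0, smul_zero, add_zero] at this
  intro j hj
  obtain ⟨l, rfl | rfl⟩ := Nat.even_or_odd' j
  · exact he l (by omega)
  · have := ho l (by omega)
    rwa [he l (by omega), zero_add] at this

end Window

/-- The transpose of `eq_zero_of_pascalMod2_rows`: the first `r` rows of any `r` consecutive
columns. Over the finite ring `ZMod b` an injective square matrix is invertible, and so is its
transpose. -/
theorem eq_zero_of_pascalMod2_columns {b : ℕ} [NeZero b] (r s : ℕ) (v : ℕ → ZMod b)
    (h : ∀ k < r, ∑ c ∈ Finset.range r, pascalMod2 k (s + c) • v c = 0) :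
    ∀ c < r, v c = 0 := by
  let M : Matrix (Fin r) (Fin r) (ZMod b) := fun c j => (pascalMod2 (s + c) j : ZMod b)
  have hinj : Function.Injective M.mulVec := by
    refine (injective_iff_map_eq_zero M.mulVecLin).2 fun w hw => ?_
    have := eq_zero_of_pascalMod2_rows r s (fun j => if hj : j < r then w ⟨j, hj⟩ else 0)
      fun k h1 h2 => by
        have h3 := congrFun hw ⟨k - s, by omega⟩
        simp only [M, Pi.zero_apply] at h3
        rw [← h3, Finset.sum_range]
        refine Finset.sum_congr rfl fun j _ => ?_
        simp [show s + (k - s) = k by omega]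
    ext j
    simpa using this j j.2
  have hunit := Matrix.mulVec_surjective_iff_isUnit.1 (Finite.injective_iff_surjective.1 hinj)
  have hinj' := Finite.injective_iff_surjective.2 (Matrix.vecMul_surjective_iff_isUnit.2 hunit)
  have hv : (fun c : Fin r => v c) = 0 := hinj' <| by
    ext j
    simp only [Matrix.zero_vecMul, Pi.zero_apply]
    rw [← h j j.2, Finset.sum_range]
    change ∑ c : Fin r, v c * M c j = _
    refine Finset.sum_congr rfl fun c _ => ?_
    simp [M, pascalMod2_comm (j : ℕ), mul_comm]
  exact fun c hc => congrFun hv ⟨c, hc⟩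

/-! ### Perfect necklaces from injectivity -/

theorem mem_circularOccurrences_iff {A : Type*} [DecidableEq A] {w u : List A} {L : ℕ}
    {f : ℕ → A} (hw : w.length = L) (hf : ∀ p < L, w[p]? = some (f p)) {p : ℕ} :
    p ∈ circularOccurrences w u ↔ p < L ∧ ∀ j (hj : j < u.length), f ((p + j) % L) = u[j] := by
  unfold circularOccurrences
  rw [Finset.mem_filter, Finset.mem_range, hw]
  refine and_congr_right fun hp => forall_congr' fun j => ?_
  rw [Finset.mem_range]
  refine forall_congr' fun hj => ?_
  rw [hf _ (Nat.mod_lt _ (by omega)), List.getElem?_eq_getElem hj, Option.some_inj]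

/-- If for each residue `i` modulo `m` the circular word `w` of length `m * b ^ ℓ` has pairwise
different factors of length `ℓ` at the `b ^ ℓ` positions congruent to `i`, then each word of length
`ℓ` is found at exactly one of these positions. -/
theorem isPerfectNecklace_of_injective {b m ℓ : ℕ} (f : ℕ → Fin b)
    (w : List (Fin b)) (hw : w.length = m * b ^ ℓ) (hf : ∀ p < m * b ^ ℓ, w[p]? = some (f p))
    (hinj : ∀ i < m, ∀ t < b ^ ℓ, ∀ t' < b ^ ℓ,
      (∀ j < ℓ, f ((t * m + i + j) % (m * b ^ ℓ)) = f ((t' * m + i + j) % (m * b ^ ℓ))) → t = t') :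
    IsPerfectNecklace ℓ m w := by
  intro u hu
  have hex : ∀ i : Fin m, ∃ t < b ^ ℓ, ∀ j (hj : j < u.length),
      f ((t * m + i + j) % (m * b ^ ℓ)) = u[j] := by
    intro i
    let g : Fin (b ^ ℓ) → Fin ℓ → Fin b := fun t j => f ((t * m + i + j) % (m * b ^ ℓ))
    have hg : Function.Injective g := fun t t' h =>
      Fin.ext (hinj i i.2 t t.2 t' t'.2 fun j hj => congrFun h ⟨j, hj⟩)
    have hbij := (Fintype.bijective_iff_injective_and_card g).2 ⟨hg, by simp⟩
    obtain ⟨t, ht⟩ := hbij.2 fun j => u[j]'(by omega)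
    exact ⟨t, t.2, fun j hj => congrFun ht ⟨j, by omega⟩⟩
  choose t ht htu using hex
  have hocc : circularOccurrences w u = Finset.univ.image fun i : Fin m => t i * m + i := by
    ext p
    rw [mem_circularOccurrences_iff hw hf, Finset.mem_image]
    constructor
    · rintro ⟨hp, hpu⟩
      have hm : 0 < m := Nat.pos_of_mul_pos_right (by omega : 0 < m * b ^ ℓ)
      refine ⟨⟨p % m, Nat.mod_lt _ hm⟩, Finset.mem_univ _, ?_⟩
      have := hinj (p % m) (Nat.mod_lt _ hm) _ (ht ⟨p % m, Nat.mod_lt _ hm⟩) (p / m)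
        (Nat.div_lt_of_lt_mul hp) fun j hj => by
          rw [Nat.div_add_mod', hpu j (by omega)]
          exact htu ⟨p % m, Nat.mod_lt _ hm⟩ j (by omega)
      rw [this]
      exact Nat.div_add_mod' p m
    · rintro ⟨i, -, rfl⟩
      refine ⟨?_, htu i⟩
      calc t i * m + i < t i * m + m := by omega
        _ = m * (t i + 1) := by ring
        _ ≤ m * b ^ ℓ := Nat.mul_le_mul_left _ (ht i)
  have hmod : ∀ i : Fin m, (t i * m + i) % m = i := fun i => by
    rw [Nat.mul_add_mod_self_right, Nat.mod_eq_of_lt i.2]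
  rw [hocc]
  refine ⟨?_, ?_⟩
  · rw [Finset.card_image_of_injective, Finset.card_univ, Fintype.card_fin]
    intro i i' h
    have h' := congrArg (· % m) h
    simp only [hmod] at h'
    exact Fin.ext h'
  · simp only [Finset.mem_image, Finset.mem_univ, true_and]
    rintro _ ⟨i, rfl⟩ _ ⟨i', rfl⟩ h
    unfold Nat.ModEq at h
    rw [hmod, hmod] at h
    rw [Fin.ext h]

/-! ### Base-`b` digits of natural numbers -/

theorem mul_pow_add_div_pow_mod {b ℓ c : ℕ} (hb : 0 < b) (hc : c < ℓ) (j t : ℕ) :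
    (j * b ^ ℓ + t) / b ^ c % b = t / b ^ c % b := by
  obtain ⟨k, rfl⟩ : ∃ k, ℓ = c + 1 + k := ⟨ℓ - c - 1, by omega⟩
  rw [show j * b ^ (c + 1 + k) + t = t + b ^ c * (b * (j * b ^ k)) by ring,
    Nat.add_mul_div_left _ _ (by positivity), Nat.add_mul_mod_self_left]

theorem mul_pow_add_div_pow {b ℓ c t : ℕ} (hb : 0 < b) (hc : ℓ ≤ c) (ht : t < b ^ ℓ) (j : ℕ) :
    (j * b ^ ℓ + t) / b ^ c = j / b ^ (c - ℓ) := by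
  obtain ⟨k, rfl⟩ : ∃ k, c = ℓ + k := ⟨c - ℓ, by omega⟩
  rw [pow_add, ← Nat.div_div_eq_div_mul, mul_comm j, Nat.mul_add_div (by positivity),
    Nat.div_eq_of_lt ht, add_zero, Nat.add_sub_cancel_left]

theorem mod_pow_eq_of_digits {b s t t' : ℕ} (h : ∀ c < s, t / b ^ c % b = t' / b ^ c % b) :
    t % b ^ s = t' % b ^ s := by
  induction s with
  | zero => simp [Nat.mod_one]
  | succ s ih =>
    rw [Nat.mod_pow_succ, Nat.mod_pow_succ, ih fun c hc => h c (by omega), h s (by omega)]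

theorem digits_eq_of_mod_pow_eq {b s t t' : ℕ} (h : t % b ^ s = t' % b ^ s) :
    ∀ c < s, t / b ^ c % b = t' / b ^ c % b := by
  intro c hc
  have key : ∀ n, n / b ^ c % b = n % b ^ s / b ^ c % b := fun n => by
    obtain ⟨k, rfl⟩ : ∃ k, s = c + (1 + k) := ⟨s - c - 1, by omega⟩
    rw [pow_add, Nat.mod_mul_right_div_self, pow_add, pow_one, Nat.mod_mul_right_mod]
  rw [key t, key t', h]

/-! ### Levin's blocks are nested perfect necklaces -/

/-- The difference in `ZMod b` of the `c`-th base-`b` digits of `n` and `n'`. -/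
def digitDiff (b n n' c : ℕ) : ZMod b :=
  ((n / b ^ c % b : ℕ) : ZMod b) - ((n' / b ^ c % b : ℕ) : ZMod b)

theorem digitDiff_eq_zero_iff {b n n' c : ℕ} :
    digitDiff b n n' c = 0 ↔ n / b ^ c % b = n' / b ^ c % b := by
  rw [digitDiff, sub_eq_zero, ZMod.natCast_eq_natCast_iff', Nat.mod_mod, Nat.mod_mod]

theorem levinDigit_eq_iff {b m n n' k : ℕ} :
    levinDigit b m n k = levinDigit b m n' k ↔
      ∑ c ∈ Finset.range m, pascalMod2 k c • digitDiff b n n' c = 0 := by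
  unfold levinDigit
  rw [← ZMod.natCast_eq_natCast_iff', ← sub_eq_zero, Nat.cast_sum, Nat.cast_sum,
    ← Finset.sum_sub_distrib]
  simp only [digitDiff, nsmul_eq_mul, Nat.cast_mul, mul_sub]

/-- Among `b ^ ℓ` consecutive words of Levin's block, starting at an index divisible by `b ^ ℓ`,
no two agree in `ℓ` consecutive symbols at the same place. -/
theorem eq_of_levinDigit_eq_within {b m ℓ i j t t' : ℕ} (hb : 0 < b)
    (hi : i + ℓ ≤ m) (ht : t < b ^ ℓ) (ht' : t' < b ^ ℓ)
    (h : ∀ k, i ≤ k → k < i + ℓ →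
      levinDigit b m (j * b ^ ℓ + t) k = levinDigit b m (j * b ^ ℓ + t') k) : t = t' := by
  have hv := eq_zero_of_pascalMod2_rows ℓ i (digitDiff b (j * b ^ ℓ + t) (j * b ^ ℓ + t'))
    fun k h1 h2 => by
      rw [← levinDigit_eq_iff.1 (h k h1 h2)]
      refine Finset.sum_subset (Finset.range_mono (by omega)) fun c _ hc => ?_
      have hc : ℓ ≤ c := by simpa using hc
      rw [digitDiff_eq_zero_iff.2, smul_zero]
      rw [mul_pow_add_div_pow hb hc ht, mul_pow_add_div_pow hb hc ht']
  have := mod_pow_eq_of_digits (b := b) (s := ℓ) (t := t) (t' := t') fun c hc => by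
    have := digitDiff_eq_zero_iff.1 (hv c hc)
    rwa [mul_pow_add_div_pow_mod hb hc, mul_pow_add_div_pow_mod hb hc] at this
  rwa [Nat.mod_eq_of_lt ht, Nat.mod_eq_of_lt ht'] at this

/-- The same for `ℓ = s + r` consecutive symbols that are the last `s` symbols of one word and the
first `r` of the next one (cyclically). The last `s` rows of the Pascal matrix vanish beyond the
first `s` columns, so the last `s` symbols give the `s` low digits of `t`, hence those of `t + 1`; the first
`r` symbols of the next word then give the remaining digits of `t + 1`. -/
theorem eq_of_levinDigit_eq_across {b d s r j t t' : ℕ} [NeZero b]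
    (hl : s + r ≤ 2 ^ d) (ht : t < b ^ (s + r)) (ht' : t' < b ^ (s + r))
    (h₁ : ∀ k, 2 ^ d - s ≤ k → k < 2 ^ d →
      levinDigit b (2 ^ d) (j * b ^ (s + r) + t) k = levinDigit b (2 ^ d) (j * b ^ (s + r) + t') k)
    (h₂ : ∀ k < r, levinDigit b (2 ^ d) (j * b ^ (s + r) + (t + 1) % b ^ (s + r)) k =
      levinDigit b (2 ^ d) (j * b ^ (s + r) + (t' + 1) % b ^ (s + r)) k) : t = t' := by
  have hb : 0 < b := NeZero.pos b
  have hv := eq_zero_of_pascalMod2_rows s (2 ^ d - s)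
    (digitDiff b (j * b ^ (s + r) + t) (j * b ^ (s + r) + t')) fun k h1 h2 => by
      rw [← levinDigit_eq_iff.1 (h₁ k h1 (by omega))]
      refine Finset.sum_subset (Finset.range_mono (by omega)) fun c hc hc' => ?_
      rw [Finset.mem_range] at hc hc'
      rw [pascalMod2_eq_zero_of_le_add d (by omega) hc (by omega), zero_smul]
  have hmod : t % b ^ s = t' % b ^ s := mod_pow_eq_of_digits fun c hc => by
    have := digitDiff_eq_zero_iff.1 (hv c hc)
    rwa [mul_pow_add_div_pow_mod hb (by omega), mul_pow_add_div_pow_mod hb (by omega)] at this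
  have hdvd : b ^ s ∣ b ^ (s + r) := pow_dvd_pow _ (by omega)
  have hlow : (t + 1) % b ^ (s + r) % b ^ s = (t' + 1) % b ^ (s + r) % b ^ s := by
    rw [Nat.mod_mod_of_dvd _ hdvd, Nat.mod_mod_of_dvd _ hdvd]
    exact Nat.ModEq.add_right 1 hmod
  have hT := Nat.mod_lt (t + 1) (Nat.pos_of_neZero (b ^ (s + r)))
  have hT' := Nat.mod_lt (t' + 1) (Nat.pos_of_neZero (b ^ (s + r)))
  set T := (t + 1) % b ^ (s + r) with hTdef
  set T' := (t' + 1) % b ^ (s + r) with hTdef'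
  have hv0 : ∀ c < s, digitDiff b (j * b ^ (s + r) + T) (j * b ^ (s + r) + T') c = 0 :=
    fun c hc => digitDiff_eq_zero_iff.2 <| by
      rw [mul_pow_add_div_pow_mod hb (by omega), mul_pow_add_div_pow_mod hb (by omega)]
      exact digits_eq_of_mod_pow_eq hlow c hc
  have hv1 : ∀ c, s + r ≤ c → digitDiff b (j * b ^ (s + r) + T) (j * b ^ (s + r) + T') c = 0 :=
    fun c hc => digitDiff_eq_zero_iff.2 <| by
      rw [mul_pow_add_div_pow hb hc hT, mul_pow_add_div_pow hb hc hT']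
  have hv2 := eq_zero_of_pascalMod2_columns r s
    (fun c => digitDiff b (j * b ^ (s + r) + T) (j * b ^ (s + r) + T') (s + c)) fun k hk => by
      have h := levinDigit_eq_iff.1 (h₂ k hk)
      obtain ⟨e, he⟩ : ∃ e, 2 ^ d = s + r + e := ⟨2 ^ d - (s + r), by omega⟩
      rw [he, Finset.sum_range_add, Finset.sum_range_add,
        Finset.sum_eq_zero fun c hc => by rw [hv0 c (Finset.mem_range.1 hc), smul_zero],
        zero_add] at h
      rwa [Finset.sum_eq_zero (s := Finset.range e) fun c hc => by
        rw [hv1 _ (by omega), smul_zero], add_zero] at h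
  have hTT : T % b ^ (s + r) = T' % b ^ (s + r) := mod_pow_eq_of_digits fun c hc => by
    rcases lt_or_ge c s with hcs | hcs
    · have := digitDiff_eq_zero_iff.1 (hv0 c hcs)
      rwa [mul_pow_add_div_pow_mod hb hc, mul_pow_add_div_pow_mod hb hc] at this
    · have := hv2 (c - s) (by omega)
      rw [show s + (c - s) = c by omega, digitDiff_eq_zero_iff] at this
      rwa [mul_pow_add_div_pow_mod hb hc, mul_pow_add_div_pow_mod hb hc] at this
  rw [Nat.mod_eq_of_lt hT, Nat.mod_eq_of_lt hT'] at hTT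
  have h3 : t ≡ t' [MOD b ^ (s + r)] := Nat.ModEq.add_right_cancel' 1 hTT
  rwa [Nat.ModEq, Nat.mod_eq_of_lt ht, Nat.mod_eq_of_lt ht'] at h3

/-- The symbol at position `p` of the `d`-th block of Levin's construction. -/
def levinSymbol (b : ℕ) [NeZero b] (d p : ℕ) : Fin b :=
  Fin.ofNat b (levinDigit b (2 ^ d) (p / 2 ^ d) (p % 2 ^ d))

theorem val_levinSymbol (b : ℕ) [NeZero b] (d p : ℕ) :
    (levinSymbol b d p : ℕ) = levinDigit b (2 ^ d) (p / 2 ^ d) (p % 2 ^ d) := by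
  simp [levinSymbol, levinDigit]

/-- The blocks of length `m * b ^ ℓ` in the definition of nested perfect necklaces. -/
theorem getElem?_aligned_block {A : Type*} {b m k ℓ j : ℕ} (f : ℕ → A) (hℓ : ℓ ≤ k)
    (hj : j < b ^ (k - ℓ)) {w : List A}
    (hw : w = ((List.ofFn fun i : Fin (m * b ^ k) => f i).drop (j * (m * b ^ ℓ))).take
      (m * b ^ ℓ)) :
    w.length = m * b ^ ℓ ∧ ∀ p < m * b ^ ℓ, w[p]? = some (f (j * (m * b ^ ℓ) + p)) := by
  have hend : j * (m * b ^ ℓ) + m * b ^ ℓ ≤ m * b ^ k := by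
    obtain ⟨e, rfl⟩ : ∃ e, k = ℓ + e := ⟨k - ℓ, by omega⟩
    rw [Nat.add_sub_cancel_left] at hj
    calc j * (m * b ^ ℓ) + m * b ^ ℓ = m * b ^ ℓ * (j + 1) := by ring
      _ ≤ m * b ^ ℓ * b ^ e := Nat.mul_le_mul_left _ hj
      _ = m * b ^ (ℓ + e) := by rw [mul_assoc, ← pow_add]
  subst hw
  refine ⟨?_, fun p hp => ?_⟩
  · simp only [List.length_take, List.length_drop, List.length_ofFn]
    omega
  · rw [List.getElem?_take_of_lt hp, List.getElem?_drop, List.getElem?_ofFn, dif_pos (by omega)]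

theorem isNestedPerfectNecklace_levinSymbol (b : ℕ) [NeZero b] (d : ℕ) :
    IsNestedPerfectNecklace (2 ^ d) (2 ^ d)
      (List.ofFn fun i : Fin (2 ^ d * b ^ 2 ^ d) => levinSymbol b d i) := by
  have hm : 0 < 2 ^ d := by positivity
  have hb : 0 < b := NeZero.pos b
  refine ⟨by simp, fun ℓ _ hℓ j hj => ?_⟩
  rw [Fintype.card_fin] at hj ⊢
  -- The position `p` of the block lies in the word with index `p / m`, at the place `p % m`.
  have hsym : ∀ p, (levinSymbol b d (j * (2 ^ d * b ^ ℓ) + p % (2 ^ d * b ^ ℓ)) : ℕ) =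
      levinDigit b (2 ^ d) (j * b ^ ℓ + p / 2 ^ d % b ^ ℓ) (p % 2 ^ d) := fun p => by
    rw [val_levinSymbol, Nat.mod_mul,
      show j * (2 ^ d * b ^ ℓ) + (p % 2 ^ d + 2 ^ d * (p / 2 ^ d % b ^ ℓ)) =
        p % 2 ^ d + 2 ^ d * (j * b ^ ℓ + p / 2 ^ d % b ^ ℓ) by ring,
      Nat.add_mul_div_left _ _ hm, Nat.div_eq_of_lt (Nat.mod_lt _ hm), zero_add,
      Nat.add_mul_mod_self_left, Nat.mod_mod]
  obtain ⟨hlen, hget⟩ := getElem?_aligned_block (m := 2 ^ d) (levinSymbol b d) hℓ hj rfl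
  refine isPerfectNecklace_of_injective
    (fun p => levinSymbol b d (j * (2 ^ d * b ^ ℓ) + p)) _ hlen hget ?_
  intro i hi t ht t' ht' h
  have h' : ∀ k < ℓ, levinDigit b (2 ^ d) (j * b ^ ℓ + (t * 2 ^ d + i + k) / 2 ^ d % b ^ ℓ)
      ((t * 2 ^ d + i + k) % 2 ^ d) =
      levinDigit b (2 ^ d) (j * b ^ ℓ + (t' * 2 ^ d + i + k) / 2 ^ d % b ^ ℓ)
      ((t' * 2 ^ d + i + k) % 2 ^ d) := fun k hk => by
    rw [← hsym, ← hsym]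
    exact congrArg Fin.val (h k hk)
  have hin : ∀ x y, y < 2 ^ d → (x * 2 ^ d + y) / 2 ^ d = x ∧ (x * 2 ^ d + y) % 2 ^ d = y :=
    fun x y hy => by
      rw [mul_comm, Nat.mul_add_div hm, Nat.div_eq_of_lt hy, Nat.mul_add_mod,
        Nat.mod_eq_of_lt hy, add_zero]
      exact ⟨rfl, rfl⟩
  rcases le_or_gt (i + ℓ) (2 ^ d) with hle | hgt
  · refine eq_of_levinDigit_eq_within hb hle ht ht' (j := j) fun k h1 h2 => ?_
    have := h' (k - i) (by omega)
    rwa [add_assoc, add_assoc, show i + (k - i) = k by omega, (hin t k (by omega)).1,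
      (hin t k (by omega)).2, (hin t' k (by omega)).1, (hin t' k (by omega)).2,
      Nat.mod_eq_of_lt ht, Nat.mod_eq_of_lt ht'] at this
  · obtain ⟨r, rfl⟩ : ∃ r, ℓ = (2 ^ d - i) + r := ⟨ℓ - (2 ^ d - i), by omega⟩
    refine eq_of_levinDigit_eq_across hℓ ht ht' (j := j) (fun k h1 h2 => ?_) fun k hk => ?_
    · have := h' (k - i) (by omega)
      rwa [add_assoc, add_assoc, show i + (k - i) = k by omega, (hin t k (by omega)).1,
        (hin t k (by omega)).2, (hin t' k (by omega)).1, (hin t' k (by omega)).2,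
        Nat.mod_eq_of_lt ht, Nat.mod_eq_of_lt ht'] at this
    · have := h' (2 ^ d - i + k) (by omega)
      have hrw : ∀ x, x * 2 ^ d + i + (2 ^ d - i + k) = (x + 1) * 2 ^ d + k := fun x => by
        rw [add_mul, one_mul]; omega
      rwa [hrw, hrw, (hin _ k (by omega)).1, (hin _ k (by omega)).2, (hin _ k (by omega)).1,
        (hin _ k (by omega)).2] at this

/-! ### Expansions in base `b` -/

/-- The value of the word `a p, …, a (p + ℓ - 1)`, read as a number in base `b`, most significant
digit first. -/
def wordValue {b : ℕ} (a : ℕ → Fin b) (p : ℕ) : ℕ → ℕ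
  | 0 => 0
  | ℓ + 1 => b * wordValue a p ℓ + a (p + ℓ)

theorem mul_sum_ofDigitsTerm {b : ℕ} (a : ℕ → Fin b) (n : ℕ) :
    (b : ℝ) ^ n * ∑ i ∈ Finset.range n, Real.ofDigitsTerm a i = wordValue a 0 n := by
  have hb : (b : ℝ) ≠ 0 := Nat.cast_ne_zero.2 (Fin.pos (a 0)).ne'
  induction n with
  | zero => simp [wordValue]
  | succ n ih =>
    rw [Finset.sum_range_succ, mul_add, pow_succ', mul_assoc, ih, Real.ofDigitsTerm, wordValue,
      ← pow_succ', mul_left_comm, mul_inv_cancel₀ (pow_ne_zero _ hb), mul_one, zero_add]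
    push_cast
    rfl

theorem ofDigits_lt_one {b : ℕ} (hb : 1 < b) {a : ℕ → Fin b} (ha : ∃ i, (a i : ℕ) = 0) :
    Real.ofDigits a < 1 := by
  obtain ⟨i, hi⟩ := ha
  rw [← Real.ofDigits_const_last_eq_one' hb]
  refine Summable.tsum_lt_tsum (i := i) (fun n => ?_) ?_ Real.summable_ofDigitsTerm
    Real.summable_ofDigitsTerm
  · unfold Real.ofDigitsTerm
    gcongr
    exact Nat.le_sub_one_of_lt (a n).2
  · unfold Real.ofDigitsTerm
    have : 0 < b := by omega
    gcongr
    rw [hi]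
    show 0 < b - 1
    omega

theorem digits_ofDigits {b : ℕ} [NeZero b] (hb : 1 < b) {a : ℕ → Fin b}
    (ha : ∀ n, ∃ i, n ≤ i ∧ (a i : ℕ) = 0) : Real.digits (Real.ofDigits a) b = a := by
  funext n
  set t := Real.ofDigits fun i => a (i + (n + 1)) with ht
  have ht0 : 0 ≤ t := Real.ofDigits_nonneg _
  have ht1 : t < 1 := ofDigits_lt_one hb <| by
    obtain ⟨i, hi, h0⟩ := ha (n + 1)
    exact ⟨i - (n + 1), by rwa [Nat.sub_add_cancel hi]⟩
  have hx : Real.ofDigits a * (b : ℝ) ^ (n + 1) = wordValue a 0 (n + 1) + t := by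
    have hb0 : (b : ℝ) ^ (n + 1) ≠ 0 := pow_ne_zero _ (Nat.cast_ne_zero.2 (NeZero.ne b))
    rw [Real.ofDigits_eq_sum_add_ofDigits a (n + 1), mul_comm, mul_add, mul_sum_ofDigitsTerm,
      mul_inv_cancel_left₀ hb0]
  have hfloor : ⌊Real.ofDigits a * (b : ℝ) ^ (n + 1)⌋₊ = wordValue a 0 (n + 1) := by
    rw [hx, Nat.floor_eq_iff (by positivity)]
    exact ⟨by linarith, by linarith⟩
  ext
  rw [Real.digits, hfloor, Fin.val_ofNat, wordValue, Nat.mul_add_mod, zero_add,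
    Nat.mod_eq_of_lt (a n).2]

/-- Shifting the point by `p` places and reading off the first `ℓ` digits gives the word of length
`ℓ` at position `p` of the expansion. -/
theorem floor_pow_mul_fract {b : ℕ} [NeZero b] {x : ℝ} (hx : 0 ≤ x) (p ℓ : ℕ) :
    ⌊(b : ℝ) ^ ℓ * Int.fract ((b : ℝ) ^ p * x)⌋₊ = wordValue (Real.digits x b) p ℓ := by
  induction ℓ with
  | zero => simpa [wordValue, Nat.floor_eq_zero] using Int.fract_lt_one _
  | succ ℓ ih =>
    have hb : b ≠ 0 := NeZero.ne b
    set y := Int.fract ((b : ℝ) ^ p * x) with hy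
    have hy0 : 0 ≤ y := Int.fract_nonneg _
    have hsplit : x * (b : ℝ) ^ (p + ℓ + 1) =
        (b : ℝ) ^ (ℓ + 1) * y + ((b ^ (ℓ + 1) * ⌊(b : ℝ) ^ p * x⌋₊ : ℕ) : ℝ) := by
      push_cast
      rw [natCast_floor_eq_intCast_floor (by positivity), ← mul_add, hy, Int.fract_add_floor]
      ring
    have hdigit : (Real.digits x b (p + ℓ) : ℕ) = ⌊(b : ℝ) ^ (ℓ + 1) * y⌋₊ % b := by
      rw [Real.digits, Fin.val_ofNat, hsplit, Nat.floor_add_natCast (by positivity),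
        pow_succ' b ℓ, mul_assoc b, Nat.add_mul_mod_self_left]
    rw [wordValue, ← ih, hdigit,
      ← Nat.cast_mul_floor_div_cancel (a := (b : ℝ) ^ ℓ * y) hb, ← mul_assoc, ← pow_succ',
      Nat.div_add_mod]

theorem blockStart_succ (b d : ℕ) :
    blockStart b (d + 1) = blockStart b d + 2 ^ d * b ^ 2 ^ d :=
  Finset.sum_range_succ _ _

theorem blockStart_mono (b : ℕ) : Monotone (blockStart b) :=
  monotone_nat_of_le_succ fun d => by rw [blockStart_succ]; omega

theorem le_blockStart (b : ℕ) [NeZero b] (d : ℕ) : d ≤ blockStart b d := by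
  induction d with
  | zero => simp
  | succ d ih =>
    rw [blockStart_succ]
    have := Nat.pos_of_neZero (2 ^ d * b ^ 2 ^ d)
    omega

theorem exists_lt_blockStart (b : ℕ) [NeZero b] (n : ℕ) : ∃ d, n < blockStart b (d + 1) :=
  ⟨n, le_blockStart b (n + 1)⟩

/-- The index of the block that contains the position `n`. -/
def blockIndex (b : ℕ) [NeZero b] (n : ℕ) : ℕ := Nat.find (exists_lt_blockStart b n)

theorem lt_blockStart_blockIndex_succ (b : ℕ) [NeZero b] (n : ℕ) :
    n < blockStart b (blockIndex b n + 1) := Nat.find_spec (exists_lt_blockStart b n)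

theorem blockStart_blockIndex_le (b : ℕ) [NeZero b] (n : ℕ) : blockStart b (blockIndex b n) ≤ n := by
  cases h : blockIndex b n with
  | zero => simp [blockStart]
  | succ d =>
    have := Nat.find_min (exists_lt_blockStart b n) (m := d) (by unfold blockIndex at h; omega)
    omega

theorem blockIndex_blockStart_add {b d p : ℕ} [NeZero b] (hp : p < 2 ^ d * b ^ 2 ^ d) :
    blockIndex b (blockStart b d + p) = d := by
  refine (Nat.find_eq_iff _).2 ⟨by rw [blockStart_succ]; omega, fun e he => ?_⟩
  have := blockStart_mono b (Nat.succ_le_of_lt he)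
  simp only [Nat.succ_eq_add_one] at this
  omega

/-- The concatenation of all blocks of Levin's construction. -/
def levinSequence (b : ℕ) [NeZero b] (n : ℕ) : Fin b :=
  levinSymbol b (blockIndex b n) (n - blockStart b (blockIndex b n))

theorem levinSequence_blockStart_add {b d p : ℕ} [NeZero b] (hp : p < 2 ^ d * b ^ 2 ^ d) :
    levinSequence b (blockStart b d + p) = levinSymbol b d p := by
  rw [levinSequence, blockIndex_blockStart_add hp, Nat.add_sub_cancel_left]

theorem exists_levinSequence_eq_zero (b : ℕ) [NeZero b] (n : ℕ) :
    ∃ i, n ≤ i ∧ (levinSequence b i : ℕ) = 0 := by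
  refine ⟨blockStart b n + 0, le_blockStart b n, ?_⟩
  rw [levinSequence_blockStart_add (Nat.pos_of_neZero _), val_levinSymbol]
  simp [levinDigit]

theorem sum_range_mul_eq {G : Type*} [AddCommMonoid G] (f : ℕ → G) (m B : ℕ) :
    ∑ p ∈ Finset.range (m * B), f p =
      ∑ n ∈ Finset.range B, ∑ i ∈ Finset.range m, f (n * m + i) := by
  induction B with
  | zero => simp
  | succ B ih =>
    rw [mul_add, mul_one, Finset.sum_range_add, Finset.sum_range_succ, ih, mul_comm m B]

theorem levinNumber_eq_ofDigits (b : ℕ) [NeZero b] :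
    levinNumber b = Real.ofDigits (levinSequence b) := by
  have hblock : ∀ d, ∑ n ∈ Finset.range (b ^ 2 ^ d), ∑ i ∈ Finset.range (2 ^ d),
      (levinDigit b (2 ^ d) n i : ℝ) / (b : ℝ) ^ (blockStart b d + n * 2 ^ d + i + 1) =
      ∑ p ∈ Finset.range (2 ^ d * b ^ 2 ^ d),
        Real.ofDigitsTerm (levinSequence b) (blockStart b d + p) := fun d => by
    rw [sum_range_mul_eq]
    refine Finset.sum_congr rfl fun n hn => Finset.sum_congr rfl fun i hi => ?_
    rw [Finset.mem_range] at hn hi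
    have hm : 0 < 2 ^ d := by positivity
    have hp : n * 2 ^ d + i < 2 ^ d * b ^ 2 ^ d := by
      calc n * 2 ^ d + i < n * 2 ^ d + 2 ^ d := by omega
        _ = 2 ^ d * (n + 1) := by ring
        _ ≤ 2 ^ d * b ^ 2 ^ d := Nat.mul_le_mul_left _ hn
    rw [Real.ofDigitsTerm, levinSequence_blockStart_add hp, val_levinSymbol, mul_comm n,
      Nat.mul_add_div hm, Nat.div_eq_of_lt hi, Nat.mul_add_mod, Nat.mod_eq_of_lt hi, add_zero,
      div_eq_mul_inv, ← add_assoc]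
  have hpartial : ∀ D, ∑ d ∈ Finset.range D, ∑ p ∈ Finset.range (2 ^ d * b ^ 2 ^ d),
      Real.ofDigitsTerm (levinSequence b) (blockStart b d + p) =
      ∑ n ∈ Finset.range (blockStart b D), Real.ofDigitsTerm (levinSequence b) n := fun D => by
    induction D with
    | zero => simp [blockStart]
    | succ D ih => rw [Finset.sum_range_succ, ih, blockStart_succ, Finset.sum_range_add]
  unfold levinNumber
  simp only [hblock]
  refine HasSum.tsum_eq ((hasSum_iff_tendsto_nat_of_nonneg (fun d =>
    Finset.sum_nonneg fun p _ => Real.ofDigitsTerm_nonneg) _).2 ?_)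
  simp only [hpartial]
  exact Real.summable_ofDigitsTerm.hasSum.tendsto_sum_nat.comp
    (Filter.tendsto_atTop_mono (le_blockStart b) Filter.tendsto_id)

theorem isNestedPerfectConcatenation_levinSequence (b : ℕ) [NeZero b] :
    IsNestedPerfectConcatenation (levinSequence b) := fun d => by
  have : (fun i : Fin (2 ^ d * b ^ 2 ^ d) => levinSequence b (blockStart b d + i)) =
      fun i : Fin (2 ^ d * b ^ 2 ^ d) => levinSymbol b d i :=
    funext fun i => levinSequence_blockStart_add i.2
  rw [this]
  exact isNestedPerfectNecklace_levinSymbol b d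

theorem levinNumber_spec (b : ℕ) [NeZero b] (hb : 2 ≤ b) :
    0 ≤ levinNumber b ∧ levinNumber b < 1 ∧
      IsNestedPerfectConcatenation (Real.digits (levinNumber b) b) := by
  rw [levinNumber_eq_ofDigits]
  refine ⟨Real.ofDigits_nonneg _, ofDigits_lt_one hb ?_, ?_⟩
  · obtain ⟨i, -, hi⟩ := exists_levinSequence_eq_zero b 0
    exact ⟨i, hi⟩
  · rw [digits_ofDigits hb (exists_levinSequence_eq_zero b)]
    exact isNestedPerfectConcatenation_levinSequence b

/-! ### Counting in a perfect necklace -/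

theorem wordValue_congr {b : ℕ} {a a' : ℕ → Fin b} {p p' ℓ : ℕ}
    (h : ∀ j < ℓ, a (p + j) = a' (p' + j)) : wordValue a p ℓ = wordValue a' p' ℓ := by
  induction ℓ with
  | zero => rfl
  | succ ℓ ih => rw [wordValue, wordValue, ih fun j hj => h j (by omega), h ℓ (by omega)]

theorem exists_word_of_value {b : ℕ} (hb : 0 < b) (ℓ : ℕ) : ∀ v < b ^ ℓ, ∃ u : ℕ → Fin b,
    ∀ (a : ℕ → Fin b) (p : ℕ), wordValue a p ℓ = v ↔ ∀ j < ℓ, a (p + j) = u j := by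
  induction ℓ with
  | zero =>
    intro v hv
    exact ⟨fun _ => ⟨0, hb⟩, fun a p => by simp at hv; simp [wordValue, hv]⟩
  | succ ℓ ih =>
    intro v hv
    obtain ⟨u, hu⟩ := ih (v / b) (Nat.div_lt_of_lt_mul (by rwa [pow_succ'] at hv))
    refine ⟨fun j => if j < ℓ then u j else ⟨v % b, Nat.mod_lt _ hb⟩, fun a p => ?_⟩
    have hsplit : wordValue a p (ℓ + 1) = v ↔
        wordValue a p ℓ = v / b ∧ (a (p + ℓ) : ℕ) = v % b := by
      rw [wordValue]
      constructor
      · rintro rfl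
        rw [Nat.mul_add_div hb, Nat.mul_add_mod, Nat.div_eq_of_lt (a _).2,
          Nat.mod_eq_of_lt (a _).2, add_zero]
        exact ⟨rfl, rfl⟩
      · rintro ⟨h1, h2⟩
        rw [h1, h2, Nat.div_add_mod]
    rw [hsplit, hu]
    constructor
    · rintro ⟨h1, h2⟩ j hj
      dsimp only
      split_ifs with hjl
      · exact h1 j hjl
      · obtain rfl : j = ℓ := by omega
        exact Fin.ext h2
    · intro h
      refine ⟨fun j hj => by simpa [hj] using h j (by omega), ?_⟩
      have := h ℓ (by omega)
      simp only [lt_irrefl, if_false] at this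
      rw [this]

/-- In a perfect necklace, read cyclically, exactly `m * k` positions carry one of the first `k`
words of length `ℓ`. -/
theorem card_circular_wordValue_lt {b m ℓ L : ℕ} {w : List (Fin b)} {f : ℕ → Fin b}
    (h : IsPerfectNecklace ℓ m w) (hw : w.length = L) (hf : ∀ p < L, w[p]? = some (f p))
    {k : ℕ} (hk : k ≤ b ^ ℓ) :
    ((Finset.range L).filter fun p => wordValue (fun q => f (q % L)) p ℓ < k).card = m * k := by
  induction k with
  | zero => simp
  | succ k ih =>
    obtain ⟨u, hu⟩ := exists_word_of_value (Fin.pos (f 0)) ℓ k hk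
    have hcard := (h (List.ofFn fun j : Fin ℓ => u j) (by simp)).1
    have heq : circularOccurrences w (List.ofFn fun j : Fin ℓ => u j) =
        (Finset.range L).filter fun p => wordValue (fun q => f (q % L)) p ℓ = k := by
      ext p
      rw [mem_circularOccurrences_iff hw hf, Finset.mem_filter, Finset.mem_range, hu]
      simp
    rw [heq] at hcard
    have hunion : ((Finset.range L).filter fun p => wordValue (fun q => f (q % L)) p ℓ < k + 1) =
        ((Finset.range L).filter fun p => wordValue (fun q => f (q % L)) p ℓ < k) ∪
        ((Finset.range L).filter fun p => wordValue (fun q => f (q % L)) p ℓ = k) := by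
      rw [← Finset.filter_or]
      exact Finset.filter_congr fun p _ => Nat.lt_succ_iff_lt_or_eq
    rw [hunion, Finset.card_union_of_disjoint, ih (by omega), hcard, mul_add, mul_one]
    exact Finset.disjoint_filter.2 fun p _ h1 h2 => by omega

/-! ### Counting points of an orbit below a threshold -/

/-- The number of `p ∈ [s, s + L)` with `y p < γ`, minus its expected value `L * γ`. -/
noncomputable def countError (y : ℕ → ℝ) (γ : ℝ) (s L : ℕ) : ℝ :=
  ((Finset.range L).filter fun p => y (s + p) < γ).card - L * γ

theorem countError_zero (y : ℕ → ℝ) (γ : ℝ) (s : ℕ) : countError y γ s 0 = 0 := by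
  simp [countError]

theorem countError_add (y : ℕ → ℝ) (γ : ℝ) (s L₁ L₂ : ℕ) :
    countError y γ s (L₁ + L₂) = countError y γ s L₁ + countError y γ (s + L₁) L₂ := by
  simp only [countError, Finset.card_filter, Finset.sum_range_add, Nat.cast_add, add_assoc]
  ring

theorem abs_countError_le (y : ℕ → ℝ) {γ : ℝ} (h0 : 0 ≤ γ) (h1 : γ ≤ 1) (s L : ℕ) :
    |countError y γ s L| ≤ L := by
  have hc : (((Finset.range L).filter fun p => y (s + p) < γ).card : ℝ) ≤ L := by
    exact_mod_cast (Finset.card_filter_le _ _).trans_eq (Finset.card_range L)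
  have h2 : (L : ℝ) * γ ≤ L := mul_le_of_le_one_right (by positivity) h1
  have h3 : 0 ≤ (L : ℝ) * γ := by positivity
  rw [countError, abs_le]
  constructor <;> linarith [Nat.cast_nonneg (α := ℝ)
    ((Finset.range L).filter fun p => y (s + p) < γ).card]

/-- A perfect necklace contributes an error of at most `2 * m`: up to `m` for rounding the
threshold to a multiple of `b ^ (-ℓ)`, and up to `ℓ` for the positions at the end, from where a
word of length `ℓ` leaves the block. -/
theorem abs_countError_necklace_le {b m ℓ s : ℕ} {w : List (Fin b)} {a : ℕ → Fin b} {y : ℕ → ℝ}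
    (hy0 : ∀ p, 0 ≤ y p) (hy : ∀ p, ⌊(b : ℝ) ^ ℓ * y p⌋₊ = wordValue a p ℓ)
    (h : IsPerfectNecklace ℓ m w) (hw : w.length = m * b ^ ℓ)
    (hf : ∀ p < m * b ^ ℓ, w[p]? = some (a (s + p))) (hℓ : ℓ ≤ m)
    {γ : ℝ} (h0 : 0 ≤ γ) (h1 : γ ≤ 1) :
    |countError y γ s (m * b ^ ℓ)| ≤ 2 * m := by
  have hb : 0 < (b : ℝ) ^ ℓ := pow_pos (Nat.cast_pos.2 (Fin.pos (a 0))) _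
  set L := m * b ^ ℓ with hL
  set c : ℕ → ℕ := fun p => wordValue (fun q => a (s + q % L)) p ℓ
  have hcirc : ∀ p, p + ℓ ≤ L → c p = wordValue a (s + p) ℓ := fun p hp =>
    wordValue_congr fun j hj => by rw [Nat.mod_eq_of_lt (by omega), add_assoc]
  have hcount : ∀ k ≤ b ^ ℓ, ((Finset.range L).filter fun p => c p < k).card = m * k :=
    fun k hk => card_circular_wordValue_lt (f := fun q => a (s + q)) h hw hf hk
  have hγ : (b : ℝ) ^ ℓ * γ ≤ (b ^ ℓ : ℕ) := by
    push_cast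
    exact mul_le_of_le_one_right hb.le h1
  have hcardIco : (Finset.Ico (L - ℓ) L).card ≤ ℓ := by rw [Nat.card_Ico]; omega
  have hupper : ((Finset.range L).filter fun p => y (s + p) < γ).card ≤
      m * ⌈(b : ℝ) ^ ℓ * γ⌉₊ + ℓ := by
    rw [← hcount _ (Nat.ceil_le.2 hγ)]
    refine le_trans (Finset.card_le_card fun p hp => ?_)
      ((Finset.card_union_le _ (Finset.Ico (L - ℓ) L)).trans (Nat.add_le_add_left hcardIco _))
    rw [Finset.mem_filter, Finset.mem_range] at hp
    rw [Finset.mem_union, Finset.mem_filter, Finset.mem_range, Finset.mem_Ico]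
    by_cases hpl : p < L - ℓ
    · refine Or.inl ⟨hp.1, ?_⟩
      rw [hcirc p (by omega), ← hy, Nat.floor_lt (by have := hy0 (s + p); positivity)]
      exact ((mul_lt_mul_iff_right₀ hb).2 hp.2).trans_le (Nat.le_ceil _)
    · exact Or.inr ⟨by omega, hp.1⟩
  have hlower : m * ⌊(b : ℝ) ^ ℓ * γ⌋₊ ≤
      ((Finset.range L).filter fun p => y (s + p) < γ).card + ℓ := by
    rw [← hcount _ (by exact_mod_cast (Nat.floor_le (by positivity)).trans hγ)]
    refine le_trans (Finset.card_le_card fun p hp => ?_)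
      ((Finset.card_union_le _ (Finset.Ico (L - ℓ) L)).trans (Nat.add_le_add_left hcardIco _))
    rw [Finset.mem_filter, Finset.mem_range] at hp
    rw [Finset.mem_union, Finset.mem_filter, Finset.mem_range, Finset.mem_Ico]
    by_cases hpl : p < L - ℓ
    · refine Or.inl ⟨hp.1, ?_⟩
      have h2 := hp.2
      rw [hcirc p (by omega), ← hy] at h2
      have h3 := Nat.lt_of_floor_lt h2
      exact (mul_lt_mul_iff_right₀ hb).1 (h3.trans_le (Nat.floor_le (by positivity)))
    · exact Or.inr ⟨by omega, hp.1⟩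
  have hu : (((Finset.range L).filter fun p => y (s + p) < γ).card : ℝ) ≤
      m * ((b : ℝ) ^ ℓ * γ + 1) + ℓ := by
    refine (Nat.cast_le.2 hupper).trans ?_
    push_cast
    gcongr
    exact (Nat.ceil_lt_add_one (by positivity)).le
  have hl : m * ((b : ℝ) ^ ℓ * γ - 1) ≤
      ((Finset.range L).filter fun p => y (s + p) < γ).card + ℓ := by
    have hlower' := Nat.cast_le (α := ℝ).2 hlower
    push_cast at hlower'
    refine le_trans ?_ hlower'
    gcongr
    linarith [Nat.lt_floor_add_one ((b : ℝ) ^ ℓ * γ)]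
  have hℓ' : (ℓ : ℝ) ≤ m := by exact_mod_cast hℓ
  rw [countError, hL, abs_le]
  push_cast
  constructor <;> linarith

section Orbit

variable {b : ℕ} {a : ℕ → Fin b} {y : ℕ → ℝ} {γ : ℝ}

theorem abs_countError_mul_le {s M C : ℕ} {q : ℕ}
    (h : ∀ i < q, |countError y γ (s + i * M) M| ≤ C) :
    |countError y γ s (q * M)| ≤ q * C := by
  induction q with
  | zero => simp [countError_zero]
  | succ q ih =>
    rw [add_mul, one_mul, countError_add]
    refine (abs_add_le _ _).trans ?_
    push_cast
    linarith [ih fun i hi => h i (by omega), h q (by omega)]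

/-- Each aligned block of a nested perfect necklace has error at most `2 * m`. -/
theorem abs_countError_aligned_block_le {m ℓ j s : ℕ}
    (hy0 : ∀ p, 0 ≤ y p) (hy : ∀ p ℓ, ⌊(b : ℝ) ^ ℓ * y p⌋₊ = wordValue a p ℓ)
    (h : IsNestedPerfectNecklace m m (List.ofFn fun i : Fin (m * b ^ m) => a (s + i)))
    (hℓ : ℓ ≤ m) (hj : j < b ^ (m - ℓ)) (h0 : 0 ≤ γ) (h1 : γ ≤ 1) :
    |countError y γ (s + j * (m * b ^ ℓ)) (m * b ^ ℓ)| ≤ 2 * m := by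
  rcases Nat.eq_zero_or_pos ℓ with rfl | hpos
  · refine (abs_countError_le y h0 h1 _ _).trans ?_
    push_cast
    linarith [Nat.cast_nonneg (α := ℝ) m]
  · have hp := h.perfect ℓ hpos hℓ j (by rwa [Fintype.card_fin])
    rw [Fintype.card_fin] at hp
    obtain ⟨hlen, hget⟩ := getElem?_aligned_block (m := m) (fun i => a (s + i)) hℓ hj rfl
    refine abs_countError_necklace_le hy0 (fun p => hy p ℓ) hp hlen (fun p hp => ?_) hℓ h0 h1
    rw [hget p hp, add_assoc]

/-- A prefix of an aligned block of a nested perfect necklace is cut into fewer than `b` blocks of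
each of the smaller orders, and a rest of length less than `m`. -/
theorem abs_countError_prefix_le {m ℓ s : ℕ}
    (hy0 : ∀ p, 0 ≤ y p) (hy : ∀ p ℓ, ⌊(b : ℝ) ^ ℓ * y p⌋₊ = wordValue a p ℓ)
    (h : IsNestedPerfectNecklace m m (List.ofFn fun i : Fin (m * b ^ m) => a (s + i)))
    (h0 : 0 ≤ γ) (h1 : γ ≤ 1) (hℓ : ℓ ≤ m) : ∀ j < b ^ (m - ℓ), ∀ L < m * b ^ ℓ,
    |countError y γ (s + j * (m * b ^ ℓ)) L| ≤ 2 * b * m * (ℓ + 1) := by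
  have hb : 0 < b := Fin.pos (a 0)
  have hb1 : (1 : ℝ) ≤ b := by exact_mod_cast hb
  induction ℓ with
  | zero =>
    intro j _ L hL
    refine (abs_countError_le y h0 h1 _ _).trans ?_
    have : (L : ℝ) ≤ m := by exact_mod_cast (by simpa using hL.le)
    push_cast
    nlinarith [Nat.cast_nonneg (α := ℝ) m]
  | succ ℓ ih =>
    intro j hj L hL
    set M := m * b ^ ℓ with hM
    have hMb : m * b ^ (ℓ + 1) = M * b := by rw [hM, pow_succ, mul_assoc]
    rw [hMb] at hL ⊢
    have hM0 : 0 < M := Nat.pos_of_mul_pos_right (by omega : 0 < M * b)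
    have hq : L / M < b := Nat.div_lt_of_lt_mul hL
    have hidx : ∀ i ≤ L / M, j * b + i < b ^ (m - ℓ) := fun i hi => by
      calc j * b + i < j * b + b := by omega
        _ = (j + 1) * b := by ring
        _ ≤ b ^ (m - (ℓ + 1)) * b := Nat.mul_le_mul_right _ hj
        _ = b ^ (m - ℓ) := by rw [← pow_succ, show m - (ℓ + 1) + 1 = m - ℓ by omega]
    have hstart : ∀ i, s + j * (M * b) + i * M = s + (j * b + i) * M := fun i => by ring
    have hfull := abs_countError_mul_le (y := y) (γ := γ) (s := s + j * (M * b)) (M := M)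
      (C := 2 * m) (q := L / M) fun i hi => by
        rw [hstart]
        exact_mod_cast abs_countError_aligned_block_le hy0 hy h (by omega) (hidx i hi.le) h0 h1
    have hrest := ih (by omega) (j * b + L / M) (hidx _ le_rfl) (L % M) (Nat.mod_lt _ hM0)
    rw [← Nat.div_add_mod' L M, countError_add, hstart]
    refine (abs_add_le _ _).trans ?_
    have hq' : ((L / M : ℕ) : ℝ) * (2 * m : ℕ) ≤ b * (2 * m : ℕ) := by
      gcongr
    push_cast at hfull hq' ⊢
    linarith

/-- In a concatenation of nested perfect necklaces, an initial segment that ends in the `d`-th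
block has an error of order at most the square of `m = 2 ^ d`. The previous blocks contribute at
most `2 + 4 + ⋯ + 2 ^ d`. -/
theorem abs_countError_initial_segment_le
    (hy0 : ∀ p, 0 ≤ y p) (hy : ∀ p ℓ, ⌊(b : ℝ) ^ ℓ * y p⌋₊ = wordValue a p ℓ)
    (h : IsNestedPerfectConcatenation a) (h0 : 0 ≤ γ) (h1 : γ ≤ 1) {d n : ℕ}
    (hn : blockStart b d ≤ n) (hn' : n < blockStart b (d + 1)) :
    |countError y γ 0 n| ≤ 6 * b * (2 ^ d) ^ 2 := by
  have hb1 : (1 : ℝ) ≤ b := by exact_mod_cast Fin.pos (a 0)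
  have hfull : ∀ D, |countError y γ 0 (blockStart b D)| ≤ 2 * 2 ^ D := fun D => by
    induction D with
    | zero => simp [blockStart, countError_zero]
    | succ D ih =>
      rw [blockStart_succ, countError_add]
      refine (abs_add_le _ _).trans ?_
      have := abs_countError_aligned_block_le (ℓ := 2 ^ D) (j := 0) hy0 hy (h D) le_rfl
        (by simp) h0 h1
      rw [zero_mul, add_zero] at this
      push_cast at this
      rw [zero_add, pow_succ]
      linarith
  obtain ⟨L, rfl⟩ := Nat.exists_eq_add_of_le hn
  rw [blockStart_succ] at hn'
  have hrest := abs_countError_prefix_le (ℓ := 2 ^ d) hy0 hy (h d) h0 h1 le_rfl 0 (by simp) L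
    (by omega)
  rw [zero_mul, add_zero] at hrest
  push_cast at hrest
  rw [countError_add, zero_add]
  refine (abs_add_le _ _).trans ((add_le_add (hfull d) hrest).trans ?_)
  have hm : (1 : ℝ) ≤ 2 ^ d := one_le_pow₀ (by norm_num)
  generalize (2 : ℝ) ^ d = m at hm
  have h2 : m ≤ m ^ 2 := by nlinarith
  have h3 : m ≤ b * m ^ 2 := by nlinarith
  have h4 : b * m ≤ b * m ^ 2 := by nlinarith
  nlinarith

end Orbit

/-! ### The discrepancy -/

theorem two_pow_le_log {b d N : ℕ} (hb : 2 ≤ b) (hN : 2 ≤ N) (h : blockStart b d ≤ N + 1) :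
    (2 : ℝ) ^ d ≤ 4 / Real.log 2 * Real.log N := by
  have hlog2 : 0 < Real.log 2 := Real.log_pos (by norm_num)
  have hlogN : Real.log 2 ≤ Real.log N := Real.log_le_log (by norm_num) (by exact_mod_cast hN)
  rw [div_mul_eq_mul_div, le_div_iff₀ hlog2]
  cases d with
  | zero => rw [pow_zero]; linarith
  | succ e =>
    have h1 : 2 ^ 2 ^ e ≤ N ^ 2 := by
      calc 2 ^ 2 ^ e ≤ b ^ 2 ^ e := Nat.pow_le_pow_left hb _
        _ ≤ 2 ^ e * b ^ 2 ^ e := Nat.le_mul_of_pos_left _ (by positivity)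
        _ ≤ blockStart b (e + 1) := by rw [blockStart_succ]; omega
        _ ≤ N + 1 := h
        _ ≤ N ^ 2 := by nlinarith
    have h2 : Real.log ((2 : ℝ) ^ 2 ^ e) ≤ Real.log ((N : ℝ) ^ 2) :=
      Real.log_le_log (by positivity) (by exact_mod_cast h1)
    rw [Real.log_pow, Real.log_pow] at h2
    push_cast at h2
    rw [pow_succ]
    linarith

theorem card_interval_sub_eq (y : ℕ → ℝ) {α β : ℝ} (hαβ : α ≤ β) (s N : ℕ) :
    (((Finset.range N).filter fun n => α ≤ y (s + n) ∧ y (s + n) < β).card : ℝ) - N * (β - α) =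
      countError y β s N - countError y α s N := by
  have hsplit : (Finset.range N).filter (fun n => y (s + n) < β) =
      (Finset.range N).filter (fun n => y (s + n) < α) ∪
      (Finset.range N).filter (fun n => α ≤ y (s + n) ∧ y (s + n) < β) := by
    rw [← Finset.filter_or]
    refine Finset.filter_congr fun n _ => ⟨fun h => ?_, ?_⟩
    · exact (lt_or_ge (y (s + n)) α).imp_right fun h' => ⟨h', h⟩
    · rintro (h | h)
      · exact h.trans_le hαβ
      · exact h.2
  have hdisj : Disjoint ((Finset.range N).filter (fun n => y (s + n) < α))
      ((Finset.range N).filter (fun n => α ≤ y (s + n) ∧ y (s + n) < β)) :=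
    Finset.disjoint_filter.2 fun n _ h1 h2 => (h2.1.trans_lt h1).false
  rw [countError, countError, hsplit, Finset.card_union_of_disjoint hdisj]
  push_cast
  ring

theorem discrepancy_nonneg (y : ℕ → ℝ) (N : ℕ) : 0 ≤ discrepancy y N :=
  Real.sSup_nonneg <| by
    rintro r ⟨α, β, -, -, -, rfl⟩
    exact abs_nonneg _

theorem discrepancy_le_of_countError_le {y : ℕ → ℝ} {N s : ℕ} {C : ℝ} (hN : 0 < N) (hC : 0 ≤ C)
    (h : ∀ γ, 0 ≤ γ → γ ≤ 1 → |countError y γ s N| ≤ C) :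
    discrepancy (fun n => y (s + n)) N ≤ 2 * C / N := by
  have hN' : (0 : ℝ) < N := by exact_mod_cast hN
  refine Real.sSup_le ?_ (by positivity)
  rintro r ⟨α, β, hα, hαβ, hβ, rfl⟩
  have hcard := card_interval_sub_eq y hαβ.le s N
  rw [le_div_iff₀ hN', ← abs_of_pos hN', ← abs_mul, abs_of_pos hN', sub_mul, mul_comm, ← mul_assoc,
    mul_one_div_cancel hN'.ne', one_mul, mul_comm (β - α)]
  refine le_trans (le_of_eq ?_) ((abs_sub (countError y β s N) (countError y α s N)).trans
    (by linarith [h α hα (by linarith), h β (by linarith) hβ]))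
  rw [← hcard]

theorem discrepancy_isBigO (b : ℕ) [NeZero b] (hb : 2 ≤ b) (x : ℝ)
    (hx : IsNestedPerfectConcatenation (Real.digits (Int.fract x) b)) :
    (fun N : ℕ => discrepancy (fun n : ℕ => Int.fract ((b : ℝ) ^ (n + 1) * x)) N)
      =O[Filter.atTop] fun N : ℕ => Real.log (N : ℝ) ^ 2 / (N : ℝ) := by
  set y : ℕ → ℝ := fun p => Int.fract ((b : ℝ) ^ p * Int.fract x) with hydef
  have hxy : (fun n : ℕ => Int.fract ((b : ℝ) ^ (n + 1) * x)) = fun n => y (1 + n) := by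
    funext n
    rw [hydef, add_comm 1 n]
    refine Int.fract_eq_fract.2 ⟨(b : ℤ) ^ (n + 1) * ⌊x⌋, ?_⟩
    rw [← mul_sub, Int.self_sub_fract]
    push_cast
    rfl
  have hy0 : ∀ p, 0 ≤ y p := fun p => Int.fract_nonneg _
  have hy : ∀ p ℓ, ⌊(b : ℝ) ^ ℓ * y p⌋₊ = wordValue (Real.digits (Int.fract x) b) p ℓ :=
    floor_pow_mul_fract (Int.fract_nonneg x)
  rw [hxy]
  refine Asymptotics.IsBigO.of_bound (14 * b * (4 / Real.log 2) ^ 2) ?_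
  filter_upwards [Filter.eventually_ge_atTop 2] with N hN
  have hb1 : (1 : ℝ) ≤ b := by exact_mod_cast (by omega : 1 ≤ b)
  set d := blockIndex b (N + 1)
  have hd := blockStart_blockIndex_le b (N + 1)
  have hlog : (2 : ℝ) ^ d ≤ 4 / Real.log 2 * Real.log N := two_pow_le_log hb hN hd
  have hm : (1 : ℝ) ≤ 2 ^ d := one_le_pow₀ (by norm_num)
  have herr : ∀ γ, 0 ≤ γ → γ ≤ 1 → |countError y γ 1 N| ≤ 7 * b * (2 ^ d) ^ 2 := by
    intro γ h0 h1
    -- The sequence starts at the position `1` of the expansion, not at `0`.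
    have h2 := abs_countError_initial_segment_le hy0 hy hx h0 h1 hd
      (lt_blockStart_blockIndex_succ b (N + 1))
    have h3 := abs_countError_le y h0 h1 0 1
    rw [add_comm N 1, countError_add, zero_add] at h2
    have h4 : (1 : ℝ) ≤ b * (2 ^ d) ^ 2 := one_le_mul_of_one_le_of_one_le hb1 (one_le_pow₀ hm)
    rw [abs_le] at h2 h3 ⊢
    push_cast at h3
    rw [show 1 + N = N + 1 from add_comm _ _] at h2
    constructor <;> linarith
  have hdisc := discrepancy_le_of_countError_le (by omega) (by positivity) herr
  rw [Real.norm_of_nonneg (discrepancy_nonneg _ _), Real.norm_of_nonneg (by positivity)]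
  refine hdisc.trans ?_
  rw [← mul_div_assoc]
  refine div_le_div_of_nonneg_right ?_ (Nat.cast_nonneg N)
  calc 2 * (7 * b * ((2 : ℝ) ^ d) ^ 2) = 14 * b * (2 ^ d) ^ 2 := by ring
    _ ≤ 14 * b * (4 / Real.log 2 * Real.log N) ^ 2 := by gcongr
    _ = 14 * b * (4 / Real.log 2) ^ 2 * Real.log N ^ 2 := by ring

/-- The digits of `x` after the radix point are `Real.digits (Int.fract x) b`; the discrepancy is
that of the sequence `{b ^ n * x}`, `n = 1, 2, …`. -/
theorem theorem1 (b : ℕ) [NeZero b] (hb : 2 ≤ b) :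
    (0 ≤ levinNumber b ∧ levinNumber b < 1 ∧
      IsNestedPerfectConcatenation (Real.digits (levinNumber b) b)) ∧
    ∀ x : ℝ, IsNestedPerfectConcatenation (Real.digits (Int.fract x) b) →
      (fun N : ℕ => discrepancy (fun n : ℕ => Int.fract ((b : ℝ) ^ (n + 1) * x)) N)
        =O[Filter.atTop] fun N : ℕ => Real.log (N : ℝ) ^ 2 / (N : ℝ) := by
  exact ⟨levinNumber_spec b hb, fun x hx => discrepancy_isBigO b hb x hx⟩
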